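/- Let $\mathcal I=\mathcal I_1\times\cdots\times\mathcal I_p$ with intervals $\mathcal I_i\subseteq\mathbb R$, and let ${\mathrm d}\mu(x)=w_1(x^1)\cdots w_p(x^p)\,{\mathrm d}x^1\cdots{\mathrm d}x^p$ on $\mathcal I$, where each $w_i$ is strictly positive and integrable on $\mathcal I_i$. Assume that each space $L^2(\mathcal I_i,w_i(x)\,{\mathrm d}x,\mathbb C)$ has an infinite orthonormal basis $\{f^i_k\}_{k=0}^\infty$ consisting of polynomials. Let $\mathcal H$ be a complex Hilbert space with orthonormal basis $\{e_m\}_m$, and let $\mathsf P$ be a normalized positive operator valued measure (POVM) on the Borel sets of $\mathcal I$ acting on $\mathcal H$. Assume that $L^2(\mathcal I,\mu,\mathbb C)$ is the minimal dilation space of $\mathsf P$ with one-dimensional fibers, that is, there are functions $\psi_m\in L^2(\mathcal I,\mu,\mathbb C)$ such that $$\langle e_n|\mathsf P(X)e_m\rangle=\int_X\overline{\psi_n(x)}\,\psi_m(x)\,{\mathrm d}\mu(x)$$ for all Borel sets $X\subseteq\mathcal I$ and all $n,m$, and the linear combinations of the functions $\chi_X\psi_m$ ($X\subseteq\mathcal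 I$ Borel) are dense in $L^2(\mathcal I,\mu,\mathbb C)$. Suppose that every $\psi_m$ is a polynomial in $x=(x^1,\ldots,x^p)$ with complex coefficients. If the complex linear span of $\{\overline{\psi_n(x)}\,\psi_m(x)\}_{n,m}$ contains all polynomials in $x$ with complex coefficients (as functions on $\mathcal I$), then $\mathsf P$ is pure, i.e. an extreme point of the convex set of all POVMs on $\mathcal I$ acting on $\mathcal H$. -/

import Mathlib

open MeasureTheory

noncomputable section

/-- A (normalized) positive operator valued measure on the measurable space `Ω`, acting on the
Hilbert space `H`: a weakly countably additive map `X ↦ P X` into the positive operators with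
`P Ω = I`. Only the values on measurable sets matter, so (as for Mathlib's vector measures) the
value on a non-measurable set is fixed to be `0`; thus two POVMs that agree on all measurable sets
are equal. -/
structure IsPOVM {Ω H : Type*} [MeasurableSpace Ω] [NormedAddCommGroup H]
    [InnerProductSpace ℂ H] [CompleteSpace H] (P : Set Ω → H →L[ℂ] H) : Prop where
  not_measurable : ∀ X : Set Ω, ¬ MeasurableSet X → P X = 0
  isPositive : ∀ X : Set Ω, MeasurableSet X → (P X).IsPositive
  univ : P Set.univ = ContinuousLinearMap.id ℂ H
  hasSum_iUnion : ∀ X : ℕ → Set Ω, (∀ k, MeasurableSet (X k)) →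
    Pairwise (Function.onFun Disjoint X) → ∀ φ η : H,
      HasSum (fun k => inner ℂ φ (P (X k) η)) (inner ℂ φ (P (⋃ k, X k) η))

/-- A POVM is pure if it is an extreme point of the convex set of all POVMs with the same outcome
space and the same Hilbert space. -/
def IsPurePOVM {Ω H : Type*} [MeasurableSpace Ω] [NormedAddCommGroup H]
    [InnerProductSpace ℂ H] [CompleteSpace H] (P : Set Ω → H →L[ℂ] H) : Prop :=
  P ∈ Set.extremePoints ℝ {F : Set Ω → H →L[ℂ] H | IsPOVM F}

/-- The functions `ψ m : Ω → ℂ` realize `L²(Ω, μ, ℂ)` (all fibers one-dimensional) as the minimal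
dilation space of `P` with respect to the orthonormal basis `e`:
the `ψ m` are square integrable,
`P X = ∑ₙₘ (∫_X conj (ψ n) * ψ m dμ) |e n⟩⟨e m|` weakly for every measurable `X`, and the linear
combinations of the functions `χ_X ψ m` are dense in `L²(Ω, μ, ℂ)`. -/
structure IsMinimalScalarDilation {Ω H ι : Type*} [MeasurableSpace Ω] [NormedAddCommGroup H]
    [InnerProductSpace ℂ H] [CompleteSpace H] (P : Set Ω → H →L[ℂ] H) (e : HilbertBasis ι ℂ H)
    (μ : Measure Ω) (ψ : ι → Ω → ℂ) : Prop where
  memLp : ∀ m, MemLp (ψ m) 2 μ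
  inner_eq : ∀ X : Set Ω, MeasurableSet X → ∀ n m,
    inner ℂ (e n) (P X (e m)) = ∫ x in X, starRingEnd ℂ (ψ n x) * ψ m x ∂μ
  dense : Dense (Submodule.span ℂ {f : Lp ℂ 2 μ | ∃ (X : Set Ω) (m : ι), MeasurableSet X ∧
    (f : Ω → ℂ) =ᵐ[μ] X.indicator (ψ m)} : Set (Lp ℂ 2 μ))

/-- The measure `w(x) dx` on the interval `I`. -/
def intervalWeightMeasure (I : Set ℝ) (w : ℝ → ℝ) : Measure I :=
  (Measure.comap Subtype.val volume : Measure I).withDensity fun x => ENNReal.ofReal (w x)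

/-- The measure `w₁(x¹) ⋯ w_p(xᵖ) dx¹ ⋯ dxᵖ` on the box `I₁ × ⋯ × I_p`. -/
def boxWeightMeasure {p : ℕ} (I : Fin p → Set ℝ) (w : Fin p → ℝ → ℝ) : Measure (∀ i, I i) :=
  (Measure.pi fun i => (Measure.comap Subtype.val volume : Measure (I i))).withDensity fun x =>
    ENNReal.ofReal (∏ i, w i (x i))

/-- `L²(I, w(x) dx, ℂ)` has an orthonormal basis consisting of polynomials. -/
def HasPolynomialONB (I : Set ℝ) (w : ℝ → ℝ) : Prop :=
  ∃ f : HilbertBasis ℕ ℂ (Lp ℂ 2 (intervalWeightMeasure I w)), ∀ k, ∃ q : Polynomial ℂ,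
    (f k : I → ℂ) =ᵐ[intervalWeightMeasure I w] fun x => q.eval ((x : ℝ) : ℂ)

/-- The polynomial function on the box `I₁ × ⋯ × I_p` given by a complex polynomial in `p`
variables. -/
def boxPolynomial {p : ℕ} (I : Fin p → Set ℝ) (q : MvPolynomial (Fin p) ℂ) : (∀ i, I i) → ℂ :=
  fun x => MvPolynomial.eval (fun i => ((x i : ℝ) : ℂ)) q

end

/-! Suppose `P = a A + b B` is a proper convex combination of POVMs. Then `A ≤ a⁻¹ P`, so the matrix
elements of `A` have densities `g n m` with respect to `μ`. Almost everywhere, finite sections of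
the matrix `g` are positive semidefinite and dominated by `a⁻¹` times the rank-one matrix `conj ψₙ
ψₘ`, which forces `g n m = T conj ψₙ ψₘ` for a scalar function `T`. Because `1` is a finite
combination of the `conj ψₙ ψₘ`, `T` is the same combination of the `g n m`, and `‖T‖ ≤ a⁻¹`
(`exists_bounded_relative_density`).

Both POVMs are normalized, so `T - 1` integrates to zero against every `conj ψₙ ψₘ`, hence against
every polynomial. Since `T - 1` is bounded, it suffices to approximate indicators of rectangles in
`L¹` by polynomials. The one-dimensional polynomial bases do this one factor at a time
(`integral_mul_prod_eq_zero`). Hence `T = 1` almost everywhere and `A = P`. -/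

/-! ### Densities of complex measures and positive semidefinite matrices -/

theorem MeasureTheory.ComplexMeasure.exists_integrable_density {Ω : Type*} [MeasurableSpace Ω]
    (v : ComplexMeasure Ω) (μ : Measure Ω) [SigmaFinite μ]
    (h : ∀ X, MeasurableSet X → μ X = 0 → v X = 0) :
    ∃ g : Ω → ℂ, Integrable g μ ∧ ∀ X, MeasurableSet X → v X = ∫ x in X, g x ∂μ := by
  have hac : v ≪ᵥ μ.toENNRealVectorMeasure := by
    refine VectorMeasure.AbsolutelyContinuous.mk fun X hX h0 => h X hX ?_
    rwa [Measure.toENNRealVectorMeasure_apply_measurable hX] at h0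
  rw [ComplexMeasure.absolutelyContinuous_ennreal_iff] at hac
  have hre := SignedMeasure.withDensityᵥ_rnDeriv_eq _ μ hac.1
  have him := SignedMeasure.withDensityᵥ_rnDeriv_eq _ μ hac.2
  refine ⟨v.rnDeriv μ, v.integrable_rnDeriv μ, fun X hX => ?_⟩
  have hint := (v.integrable_rnDeriv μ).integrableOn (s := X)
  apply Complex.ext
  · have h1 : (v X).re = (μ.withDensityᵥ ((ComplexMeasure.re v).rnDeriv μ)) X := by rw [hre]; rfl
    rw [h1, withDensityᵥ_apply (SignedMeasure.integrable_rnDeriv _ _) hX]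
    exact integral_re hint
  · have h1 : (v X).im = (μ.withDensityᵥ ((ComplexMeasure.im v).rnDeriv μ)) X := by rw [him]; rfl
    rw [h1, withDensityᵥ_apply (SignedMeasure.integrable_rnDeriv _ _) hX]
    exact integral_im hint

theorem ae_re_le_of_forall_setIntegral_re_le {Ω : Type*} [MeasurableSpace Ω] {μ : Measure Ω}
    {f g : Ω → ℂ} (hf : Integrable f μ) (hg : Integrable g μ)
    (h : ∀ X, MeasurableSet X → (∫ x in X, f x ∂μ).re ≤ (∫ x in X, g x ∂μ).re) :
    ∀ᵐ x ∂μ, (f x).re ≤ (g x).re := by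
  refine ae_le_of_forall_setIntegral_le hf.re hg.re fun X hX _ => ?_
  have h1 : ∫ x in X, RCLike.re (f x) ∂μ = RCLike.re (∫ x in X, f x ∂μ) := integral_re hf.integrableOn
  have h2 : ∫ x in X, RCLike.re (g x) ∂μ = RCLike.re (∫ x in X, g x ∂μ) := integral_re hg.integrableOn
  exact (h1.trans_le (h X hX)).trans_eq h2.symm

theorem HilbertBasis.clm_ext {H ι : Type*} [NormedAddCommGroup H] [InnerProductSpace ℂ H]
    (e : HilbertBasis ι ℂ H) {S T : H →L[ℂ] H}
    (h : ∀ n m, inner ℂ (e n) (S (e m)) = inner ℂ (e n) (T (e m))) : S = T := by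
  refine ContinuousLinearMap.ext_on (s := Set.range e) ?_ ?_
  · rw [dense_iff_closure_eq, ← Submodule.topologicalClosure_coe, e.dense_span]
    rfl
  · rintro _ ⟨m, rfl⟩
    apply e.repr.injective
    ext n
    rw [e.repr_apply_apply, e.repr_apply_apply, h]

open scoped ComplexOrder in
/-- A positive semidefinite form dominated by a form of rank one annihilates its kernel. -/
theorem Matrix.IsHermitian.mul_eq_mul_of_le_rank_one {κ : Type*} [Fintype κ] {G : Matrix κ κ ℂ}
    (hG : G.IsHermitian) {u : κ → ℂ} {C : ℝ}
    (h0 : ∀ c : κ → ℂ, 0 ≤ (star c ⬝ᵥ G.mulVec c).re)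
    (h1 : ∀ c : κ → ℂ, (star c ⬝ᵥ G.mulVec c).re ≤ C * ‖u ⬝ᵥ c‖ ^ 2) (k j l : κ) :
    G k j * u l = G k l * u j := by
  classical
  have hpos : G.PosSemidef := by
    refine Matrix.PosSemidef.of_dotProduct_mulVec_nonneg hG fun c => ?_
    rw [Complex.nonneg_iff]
    exact ⟨h0 c, (hG.im_star_dotProduct_mulVec_self c).symm⟩
  -- This vector is killed by `u`, so the form of `G` vanishes on it; positivity then gives `G c =
  -- 0`, whose entry `k` is the claim.
  set c : κ → ℂ := u l • Pi.single j 1 - u j • Pi.single l 1 with hc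
  have huc : u ⬝ᵥ c = 0 := by
    simp [hc, dotProduct_sub, dotProduct_smul, mul_comm]
  have hz : star c ⬝ᵥ G.mulVec c = 0 := by
    apply Complex.ext
    · refine le_antisymm ?_ (h0 c)
      simpa [huc] using h1 c
    · exact hG.im_star_dotProduct_mulVec_self c
  have hk := congrFun ((hpos.dotProduct_mulVec_zero_iff c).1 hz) k
  simp only [hc, Matrix.mulVec_sub, Matrix.mulVec_smul, Matrix.mulVec_single_one, Pi.sub_apply,
    Pi.smul_apply, smul_eq_mul, Pi.zero_apply, Matrix.col_apply] at hk
  linear_combination hk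

/-! ### Operator measures dominated by one with rank-one densities -/

section Domination

variable {Ω H ι : Type*} [MeasurableSpace Ω] [NormedAddCommGroup H] [InnerProductSpace ℂ H]

theorem IsPOVM.exists_integrable_density [CompleteSpace H] {A : Set Ω → H →L[ℂ] H} (hA : IsPOVM A) (μ : Measure Ω)
    [SigmaFinite μ] (hac : ∀ X, MeasurableSet X → μ X = 0 → A X = 0) (φ η : H) :
    ∃ g : Ω → ℂ, Integrable g μ ∧
      ∀ X, MeasurableSet X → inner ℂ φ (A X η) = ∫ x in X, g x ∂μ := by
  have hempty : A ∅ = 0 := by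
    ext η'
    refine ext_inner_left ℂ fun φ' => ?_
    have h := hA.hasSum_iUnion (fun _ => ∅) (fun _ => .empty) (fun i j _ => by simp [Function.onFun]) φ' η'
    -- A convergent constant series has zero terms.
    have := (summable_const_iff _).1 h.summable
    simpa using this
  let v : ComplexMeasure Ω :=
    { measureOf' := fun X => inner ℂ φ (A X η)
      empty' := by simp [hempty]
      not_measurable' := fun X hX => by simp [hA.not_measurable X hX]
      m_iUnion' := fun X hX hd => hA.hasSum_iUnion X hX hd φ η }
  refine v.exists_integrable_density μ fun X hX h0 => ?_
  change inner ℂ φ (A X η) = 0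
  simp [hac X hX h0]

variable {A P : Set Ω → H →L[ℂ] H} {e : HilbertBasis ι ℂ H} {μ : Measure Ω} {ψ : ι → Ω → ℂ}
  {C : ℝ} {g : ι → ι → Ω → ℂ}

theorem inner_sum_smul_eq_setIntegral {κ : Type*} [Fintype κ] {X : Set Ω} {T : H →L[ℂ] H}
    (hg : ∀ n m, Integrable (g n m) μ)
    (h : ∀ n m, inner ℂ (e n) (T (e m)) = ∫ x in X, g n m x ∂μ) (f : κ → ι) (c : κ → ℂ) :
    inner ℂ (∑ k, c k • e (f k)) (T (∑ k, c k • e (f k))) =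
      ∫ x in X, star c ⬝ᵥ (Matrix.of fun k l => g (f k) (f l) x).mulVec c ∂μ := by
  have : ∀ x, star c ⬝ᵥ (Matrix.of fun k l => g (f k) (f l) x).mulVec c =
      ∑ k, ∑ l, starRingEnd ℂ (c k) * c l * g (f k) (f l) x := by
    intro x
    simp only [dotProduct, Matrix.mulVec, Matrix.of_apply, Finset.mul_sum, Pi.star_apply]
    refine Finset.sum_congr rfl fun k _ => Finset.sum_congr rfl fun l _ => ?_
    rw [starRingEnd_apply]
    ring
  simp_rw [this]
  rw [integral_finsetSum _ fun k _ => integrable_finsetSum _ fun l _ =>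
    ((hg _ _).integrableOn.const_mul _)]
  simp_rw [sum_inner, map_sum, inner_sum]
  refine Finset.sum_congr rfl fun k _ => ?_
  rw [integral_finsetSum _ fun l _ => ((hg _ _).integrableOn.const_mul _)]
  refine Finset.sum_congr rfl fun l _ => ?_
  rw [integral_const_mul, ← h, map_smul, inner_smul_left, inner_smul_right]
  ring

theorem integrable_quadratic {κ : Type*} [Fintype κ] (hg : ∀ n m, Integrable (g n m) μ)
    (f : κ → ι) (c : κ → ℂ) :
    Integrable (fun x => star c ⬝ᵥ (Matrix.of fun k l => g (f k) (f l) x).mulVec c) μ := by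
  simp only [dotProduct, Matrix.mulVec, Matrix.of_apply]
  exact integrable_finsetSum _ fun k _ => (integrable_finsetSum _ fun l _ =>
    ((hg _ _).mul_const _)).const_mul _

theorem ae_density_conj (hA : ∀ X, MeasurableSet X → (A X).IsPositive)
    (hg : ∀ n m, Integrable (g n m) μ)
    (hAg : ∀ n m X, MeasurableSet X → inner ℂ (e n) (A X (e m)) = ∫ x in X, g n m x ∂μ) (n m : ι) :
    ∀ᵐ x ∂μ, g m n x = starRingEnd ℂ (g n m x) := by
  refine Integrable.ae_eq_of_forall_setIntegral_eq _ _ (hg m n)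
    ((LinearIsometryEquiv.integrable_comp_iff (RCLike.conjLIE (K := ℂ))).2 (hg n m)) fun X hX _ => ?_
  have : ∫ x in X, starRingEnd ℂ (g n m x) ∂μ = starRingEnd ℂ (∫ x in X, g n m x ∂μ) := integral_conj
  refine Eq.trans ?_ this.symm
  rw [← hAg m n X hX, ← hAg n m X hX, inner_conj_symm]
  exact ((hA X hX).isSymmetric _ _).symm

/-- For a fixed vector `c`, the inequalities between integrals over all `X` pass to the densities
off a null set depending on `c`. A countable dense set of vectors and continuity in `c` give one
null set for all. -/
theorem ae_density_quadratic (hA : ∀ X, MeasurableSet X → (A X).IsPositive)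
    (hAP : ∀ X, MeasurableSet X → ∀ φ : H,
      (inner ℂ φ (A X φ)).re ≤ C * (inner ℂ φ (P X φ)).re)
    (hψ : ∀ m, MemLp (ψ m) 2 μ)
    (hP : ∀ X : Set Ω, MeasurableSet X → ∀ n m,
      inner ℂ (e n) (P X (e m)) = ∫ x in X, starRingEnd ℂ (ψ n x) * ψ m x ∂μ)
    (hg : ∀ n m, Integrable (g n m) μ)
    (hAg : ∀ n m X, MeasurableSet X → inner ℂ (e n) (A X (e m)) = ∫ x in X, g n m x ∂μ)
    {κ : Type*} [Fintype κ] (f : κ → ι) :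
    ∀ᵐ x ∂μ, ∀ c : κ → ℂ,
      0 ≤ (star c ⬝ᵥ (Matrix.of fun k l => g (f k) (f l) x).mulVec c).re ∧
      (star c ⬝ᵥ (Matrix.of fun k l => g (f k) (f l) x).mulVec c).re ≤
        C * ‖(fun k => ψ (f k) x) ⬝ᵥ c‖ ^ 2 := by
  have hψψ : ∀ n m, Integrable (fun x => starRingEnd ℂ (ψ n x) * ψ m x) μ := fun n m =>
    (hψ n).star.integrable_mul (hψ m)
  have hrank : ∀ (c : κ → ℂ) (x : Ω), (star c ⬝ᵥ (Matrix.of fun k l =>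
      starRingEnd ℂ (ψ (f k) x) * ψ (f l) x).mulVec c) =
        ((‖(fun k => ψ (f k) x) ⬝ᵥ c‖ ^ 2 : ℝ) : ℂ) := by
    intro c x
    push_cast
    rw [← Complex.conj_mul']
    simp only [dotProduct, Matrix.mulVec, Matrix.of_apply, Pi.star_apply, map_sum, Finset.sum_mul,
      Finset.mul_sum, map_mul, starRingEnd_apply]
    rw [Finset.sum_comm]
    refine Finset.sum_congr rfl fun k _ => Finset.sum_congr rfl fun l _ => ?_
    ring
  have key : ∀ c : κ → ℂ, ∀ᵐ x ∂μ,
      0 ≤ (star c ⬝ᵥ (Matrix.of fun k l => g (f k) (f l) x).mulVec c).re ∧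
      (star c ⬝ᵥ (Matrix.of fun k l => g (f k) (f l) x).mulVec c).re ≤
        C * ‖(fun k => ψ (f k) x) ⬝ᵥ c‖ ^ 2 := by
    intro c
    have hGi := integrable_quadratic hg f c
    have hPi := (integrable_quadratic hψψ f c).const_mul (C : ℂ)
    have e1 : ∀ᵐ x ∂μ, (0 : ℂ).re ≤ _ :=
      ae_re_le_of_forall_setIntegral_re_le (integrable_zero Ω ℂ μ) hGi fun X hX => by
        rw [← inner_sum_smul_eq_setIntegral hg (fun n m => hAg n m X hX) f c]
        rw [integral_zero]
        exact (hA X hX).re_inner_nonneg_right _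
    have e2 := ae_re_le_of_forall_setIntegral_re_le hGi hPi fun X hX => by
        rw [← inner_sum_smul_eq_setIntegral hg (fun n m => hAg n m X hX) f c, integral_const_mul,
          ← inner_sum_smul_eq_setIntegral hψψ (fun n m => hP X hX n m) f c, Complex.re_ofReal_mul]
        exact hAP X hX _
    filter_upwards [e1, e2] with x h1 h2
    refine ⟨h1, ?_⟩
    rwa [hrank, Complex.re_ofReal_mul, Complex.ofReal_re] at h2
  have hall := ae_all_iff.2 fun i => key (TopologicalSpace.denseSeq (κ → ℂ) i)
  filter_upwards [hall] with x hx c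
  have hcont : Continuous fun c : κ → ℂ =>
      (star c ⬝ᵥ (Matrix.of fun k l => g (f k) (f l) x).mulVec c).re := by
    simp only [dotProduct, Matrix.mulVec, Matrix.of_apply, Pi.star_apply]
    fun_prop
  have hcont' : Continuous fun c : κ → ℂ => C * ‖(fun k => ψ (f k) x) ⬝ᵥ c‖ ^ 2 := by
    simp only [dotProduct]
    fun_prop
  exact (TopologicalSpace.denseRange_denseSeq (κ → ℂ)).induction_on
    (p := fun c => 0 ≤ (star c ⬝ᵥ (Matrix.of fun k l => g (f k) (f l) x).mulVec c).re ∧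
      (star c ⬝ᵥ (Matrix.of fun k l => g (f k) (f l) x).mulVec c).re ≤
        C * ‖(fun k => ψ (f k) x) ⬝ᵥ c‖ ^ 2) c
    ((isClosed_le continuous_const hcont).inter (isClosed_le hcont hcont')) hx

/-- If `A ≤ C P` and the scalar densities `conj ψₙ ψₘ` of `P` generate the constant function `1`,
then `A` has a bounded density relative to `P`. -/
theorem exists_bounded_relative_density (hA : ∀ X, MeasurableSet X → (A X).IsPositive)
    (hAP : ∀ X, MeasurableSet X → ∀ φ : H,
      (inner ℂ φ (A X φ)).re ≤ C * (inner ℂ φ (P X φ)).re)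
    (hψ : ∀ m, MemLp (ψ m) 2 μ)
    (hP : ∀ X : Set Ω, MeasurableSet X → ∀ n m,
      inner ℂ (e n) (P X (e m)) = ∫ x in X, starRingEnd ℂ (ψ n x) * ψ m x ∂μ)
    (hg : ∀ n m, Integrable (g n m) μ)
    (hAg : ∀ n m X, MeasurableSet X → inner ℂ (e n) (A X (e m)) = ∫ x in X, g n m x ∂μ)
    (hone : (fun _ => 1 : Ω → ℂ) ∈ Submodule.span ℂ (Set.range fun nm : ι × ι =>
        fun x => starRingEnd ℂ (ψ nm.1 x) * ψ nm.2 x)) :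
    ∃ T : Ω → ℂ, Integrable T μ ∧ (∀ᵐ x ∂μ, ‖T x‖ ≤ C) ∧
      ∀ n m, ∀ᵐ x ∂μ, g n m x = T x * (starRingEnd ℂ (ψ n x) * ψ m x) := by
  obtain ⟨c, hc⟩ := Finsupp.mem_span_range_iff_exists_finsupp.1 hone
  replace hc : ∀ x, ∑ i ∈ c.support, c i * (starRingEnd ℂ (ψ i.1 x) * ψ i.2 x) = 1 := fun x => by
    simpa [Finsupp.sum, Finset.sum_apply] using congrFun hc x
  have hconj := ae_density_conj hA hg hAg
  have hquad := fun k j l => ae_density_quadratic hA hAP hψ hP hg hAg ![k, j, l]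
  -- The rank-one lemma is applied to the 3×3 section on `k, j, l`; repeated indices are harmless.
  have hrow : ∀ k j l, ∀ᵐ x ∂μ, g k j x * ψ l x = g k l x * ψ j x := by
    intro k j l
    have hh : ∀ᵐ x ∂μ, ∀ a b : Fin 3, g (![k, j, l] b) (![k, j, l] a) x =
        starRingEnd ℂ (g (![k, j, l] a) (![k, j, l] b) x) :=
      ae_all_iff.2 fun a => ae_all_iff.2 fun b => hconj _ _
    filter_upwards [hquad k j l, hh] with x hx hherm
    have hG : (Matrix.of fun a b => g (![k, j, l] a) (![k, j, l] b) x).IsHermitian :=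
      Matrix.IsHermitian.ext fun a b => (hherm b a).symm
    exact hG.mul_eq_mul_of_le_rank_one (fun c => (hx c).1) (fun c => (hx c).2) 0 1 2
  -- Proportionality to the rank-one matrix, written without division: `hrow` exchanges column
  -- indices, its conjugate exchanges row indices.
  have hfour : ∀ i j k l, ∀ᵐ x ∂μ, g k l x * (starRingEnd ℂ (ψ i x) * ψ j x) =
      g i j x * (starRingEnd ℂ (ψ k x) * ψ l x) := by
    intro i j k l
    filter_upwards [hrow k j l, hrow j k i, hconj k j, hconj i j] with x h1 h2 h3 h4
    have h5 := congrArg (starRingEnd ℂ) h2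
    rw [map_mul, map_mul, h3, h4, Complex.conj_conj, Complex.conj_conj] at h5
    linear_combination (-starRingEnd ℂ (ψ i x)) * h1 + ψ l x * h5
  have hrel : ∀ n m, ∀ᵐ x ∂μ, g n m x =
      (∑ i ∈ c.support, c i * g i.1 i.2 x) * (starRingEnd ℂ (ψ n x) * ψ m x) := by
    intro n m
    have hall := (Finset.eventually_all c.support).2 fun i _ => hfour i.1 i.2 n m
    filter_upwards [hall] with x hx
    calc g n m x = g n m x * ∑ i ∈ c.support, c i * (starRingEnd ℂ (ψ i.1 x) * ψ i.2 x) := by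
          rw [hc, mul_one]
      _ = _ := by
          rw [Finset.mul_sum, Finset.sum_mul]
          refine Finset.sum_congr rfl fun i hi => ?_
          linear_combination c i * hx i hi
  refine ⟨_, integrable_finsetSum _ fun i _ => (hg i.1 i.2).const_mul (c i), ?_, hrel⟩
  have hall : ∀ᵐ x ∂μ, ∀ i ∈ c.support, (g i.2 i.2 x =
      (∑ i ∈ c.support, c i * g i.1 i.2 x) * (starRingEnd ℂ (ψ i.2 x) * ψ i.2 x)) ∧
      0 ≤ (g i.2 i.2 x).re ∧ (g i.2 i.2 x).re ≤ C * ‖ψ i.2 x‖ ^ 2 ∧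
      g i.2 i.2 x = starRingEnd ℂ (g i.2 i.2 x) := by
    refine (Finset.eventually_all c.support).2 fun i _ => ?_
    filter_upwards [hrel i.2 i.2, ae_density_quadratic hA hAP hψ hP hg hAg ![i.2],
      hconj i.2 i.2] with x h1 h2 h3
    have h4 := h2 fun _ => 1
    simp [dotProduct, Matrix.mulVec] at h4
    exact ⟨h1, h4.1, h4.2, h3⟩
  filter_upwards [hall] with x hx
  -- The combination equal to `1` rules out a common zero, so the bound on one diagonal entry can be
  -- divided by `‖ψ i.2 x‖ ^ 2`.
  obtain ⟨i, hi, hne⟩ : ∃ i ∈ c.support, ψ i.2 x ≠ 0 := by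
    by_contra! h
    refine zero_ne_one ((Finset.sum_eq_zero fun i hi => ?_).symm.trans (hc x))
    rw [h i hi, mul_zero, mul_zero]
  obtain ⟨h1, h2, h3, h4⟩ := hx i hi
  have hreal : g i.2 i.2 x = ((g i.2 i.2 x).re : ℂ) := (Complex.conj_eq_iff_re.1 h4.symm).symm
  have hnorm : ‖g i.2 i.2 x‖ ≤ C * ‖ψ i.2 x‖ ^ 2 := by
    rw [hreal, Complex.norm_real, Real.norm_of_nonneg h2]
    exact h3
  rw [h1, norm_mul, norm_mul, RCLike.norm_conj, ← sq] at hnorm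
  exact le_of_mul_le_mul_right hnorm (by positivity)

end Domination

/-! ### The purity criterion -/

/-- A POVM with rank-one densities `conj ψₙ ψₘ` is pure as soon as `1` lies in the span of these
densities and they separate bounded functions. -/
theorem IsPOVM.isPurePOVM_of_separating {Ω H ι : Type*} [MeasurableSpace Ω]
    [NormedAddCommGroup H] [InnerProductSpace ℂ H] [CompleteSpace H]
    {P : Set Ω → H →L[ℂ] H} (hPOVM : IsPOVM P) (e : HilbertBasis ι ℂ H)
    {μ : Measure Ω} [IsFiniteMeasure μ] {ψ : ι → Ω → ℂ}
    (hψ : ∀ m, MemLp (ψ m) 2 μ)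
    (hP : ∀ X : Set Ω, MeasurableSet X → ∀ n m,
      inner ℂ (e n) (P X (e m)) = ∫ x in X, starRingEnd ℂ (ψ n x) * ψ m x ∂μ)
    (hone : (fun _ => 1 : Ω → ℂ) ∈ Submodule.span ℂ (Set.range fun nm : ι × ι =>
        fun x => starRingEnd ℂ (ψ nm.1 x) * ψ nm.2 x))
    (hsep : ∀ (S : Ω → ℂ) (C : ℝ), Integrable S μ → (∀ᵐ x ∂μ, ‖S x‖ ≤ C) →
      (∀ n m, ∫ x, S x * (starRingEnd ℂ (ψ n x) * ψ m x) ∂μ = 0) → S =ᵐ[μ] 0) :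
    IsPurePOVM P := by
  refine mem_extremePoints_iff_left.2 ⟨hPOVM, fun A hA B hB hseg => ?_⟩
  obtain ⟨a, b, ha, hb, -, hab⟩ := hseg
  have hψψ : ∀ n m, Integrable (fun x => starRingEnd ℂ (ψ n x) * ψ m x) μ := fun n m =>
    (hψ n).star.integrable_mul (hψ m)
  have hAP : ∀ X, MeasurableSet X → ∀ φ : H,
      (inner ℂ φ (A X φ)).re ≤ a⁻¹ * (inner ℂ φ (P X φ)).re := by
    intro X hX φ
    have hB0 : 0 ≤ (inner ℂ φ (B X φ)).re := (hB.isPositive X hX).re_inner_nonneg_right φ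
    have h1 : P X φ = (a : ℂ) • A X φ + (b : ℂ) • B X φ := by rw [← hab]; rfl
    rw [h1, inner_add_right, inner_smul_right, inner_smul_right, Complex.add_re,
      Complex.re_ofReal_mul, Complex.re_ofReal_mul, mul_add, inv_mul_cancel_left₀ ha.ne']
    have : 0 ≤ a⁻¹ * (b * (inner ℂ φ (B X φ)).re) := by positivity
    linarith
  have hac : ∀ X, MeasurableSet X → μ X = 0 → A X = 0 := by
    intro X hX h0
    have hPX : P X = 0 := e.clm_ext fun n m => by
      rw [hP X hX, setIntegral_measure_zero _ h0]
      simp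
    have hsymm := (hA.isPositive X hX).isSymmetric
    rw [← ContinuousLinearMap.coe_inj]
    refine hsymm.inner_map_self_eq_zero.1 fun φ => ?_
    have h1 := hAP X hX φ
    rw [hPX, zero_apply, inner_zero_right, Complex.zero_re, mul_zero] at h1
    replace h1 : (inner ℂ (A X φ) φ).re ≤ 0 := (congrArg _ (hsymm φ φ)).trans_le h1
    rw [← hsymm.coe_re_inner_apply_self, RCLike.ofReal_eq_zero]
    exact le_antisymm h1 ((hA.isPositive X hX).re_inner_nonneg_left φ)
  choose g hg hAg using fun n m => hA.exists_integrable_density μ hac (e n) (e m)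
  obtain ⟨T, hT, hTC, hgT⟩ := exists_bounded_relative_density hA.isPositive hAP hψ hP hg hAg hone
  have hTg : ∀ n m X, MeasurableSet X →
      ∫ x in X, T x * (starRingEnd ℂ (ψ n x) * ψ m x) ∂μ = inner ℂ (e n) (A X (e m)) := by
    intro n m X hX
    rw [hAg n m X hX]
    exact integral_congr_ae (ae_restrict_of_ae ((hgT n m).mono fun x hx => hx.symm))
  -- The integrals against `conj ψₙ ψₘ` are matrix elements of `A Set.univ - P Set.univ = 0`.
  have hT1 : (fun x => T x - 1) =ᵐ[μ] 0 := by
    refine hsep _ (a⁻¹ + 1) (hT.sub (integrable_const 1)) ?_ fun n m => ?_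
    · filter_upwards [hTC] with x hx
      exact (norm_sub_le _ _).trans (by simpa using hx)
    · simp_rw [sub_mul, one_mul]
      rw [integral_sub ((hg n m).congr (hgT n m)) (hψψ n m), ← setIntegral_univ,
        hTg n m _ .univ, ← setIntegral_univ, ← hP _ .univ, hA.univ, hPOVM.univ, sub_self]
  funext X
  by_cases hX : MeasurableSet X
  · refine e.clm_ext fun n m => ?_
    rw [hP X hX, ← hTg n m X hX]
    refine integral_congr_ae (ae_restrict_of_ae (hT1.mono fun x hx => ?_))
    simp only [Pi.zero_apply, sub_eq_zero] at hx
    simp [hx]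
  · rw [hA.not_measurable X hX, hPOVM.not_measurable X hX]

/-! ### Weighted measures on intervals and boxes -/

theorem integrable_comap_subtype_iff {s : Set ℝ} (hs : MeasurableSet s) {f : ℝ → ℝ} :
    Integrable (fun x : s => f x) (Measure.comap Subtype.val volume) ↔ IntegrableOn f s := by
  rw [IntegrableOn, ← map_comap_subtype_coe hs, (MeasurableEmbedding.subtype_coe hs).integrable_map_iff]
  rfl

theorem isFiniteMeasure_intervalWeightMeasure {s : Set ℝ} (hs : MeasurableSet s) {w : ℝ → ℝ}
    (hw : IntegrableOn w s) : IsFiniteMeasure (intervalWeightMeasure s w) :=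
  isFiniteMeasure_withDensity_ofReal ((integrable_comap_subtype_iff hs).2 hw).2

theorem sigmaFinite_comap_subtype {s : Set ℝ} (hs : MeasurableSet s) :
    SigmaFinite (Measure.comap Subtype.val volume : Measure s) := by
  refine SigmaFinite.of_map _ measurable_subtype_coe.aemeasurable ?_
  rw [map_comap_subtype_coe hs]
  infer_instance

/-- By Fubini the two measures agree on rectangles; positive integrable weights allow passing to
Bochner integrals, which factor over the coordinates. -/
theorem boxWeightMeasure_eq_pi {p : ℕ} {I : Fin p → Set ℝ} (hI : ∀ i, MeasurableSet (I i))
    {w : Fin p → ℝ → ℝ} (hw_pos : ∀ i, ∀ x ∈ I i, 0 < w i x)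
    (hw_int : ∀ i, IntegrableOn (w i) (I i)) :
    boxWeightMeasure I w = Measure.pi fun i => intervalWeightMeasure (I i) (w i) := by
  have := fun i => isFiniteMeasure_intervalWeightMeasure (hI i) (hw_int i)
  have := fun i => sigmaFinite_comap_subtype (hI i)
  have hint := fun i => (integrable_comap_subtype_iff (hI i)).2 (hw_int i)
  refine (Measure.pi_eq fun s hs => ?_).symm
  rw [boxWeightMeasure, withDensity_apply _ (.univ_pi hs)]
  have hnn : ∀ x : ∀ i, I i, 0 ≤ ∏ i, w i (x i) := fun x =>
    Finset.prod_nonneg fun i _ => (hw_pos i _ (x i).2).le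
  have hone : ∀ i, intervalWeightMeasure (I i) (w i) (s i) = ENNReal.ofReal
      (∫ x, (s i).indicator (fun x : I i => w i x) x ∂(Measure.comap Subtype.val volume)) := by
    intro i
    rw [intervalWeightMeasure, withDensity_apply _ (hs i), integral_indicator (hs i),
      ofReal_integral_eq_lintegral_ofReal (hint i).integrableOn
        (ae_of_all _ fun x => (hw_pos i _ x.2).le)]
  simp_rw [hone]
  rw [← ofReal_integral_eq_lintegral_ofReal (Integrable.fintype_prod_dep hint).integrableOn
    (ae_of_all _ hnn), ← ENNReal.ofReal_prod_of_nonneg, ← integral_fintype_prod_eq_prod,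
    ← integral_indicator (.univ_pi hs)]
  · congr 2
    funext x
    by_cases hx : x ∈ Set.univ.pi s
    · rw [Set.indicator_of_mem hx]
      exact Finset.prod_congr rfl fun i _ => 
        (Set.indicator_of_mem (hx i trivial) fun y : I i => w i y).symm
    · rw [Set.indicator_of_notMem hx]
      simp only [Set.mem_pi, Set.mem_univ, true_imp_iff, not_forall] at hx
      obtain ⟨i, hi⟩ := hx
      exact (Finset.prod_eq_zero (Finset.mem_univ i) (Set.indicator_of_notMem hi _)).symm
  · intro i _
    exact integral_nonneg fun x => Set.indicator_nonneg (fun y _ => (hw_pos i _ y.2).le) x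

/-- The polynomials are dense in `L¹(I, w(x) dx)`, as far as square integrable functions are
concerned. -/
theorem HasPolynomialONB.exists_polynomial_integral_norm_sub_lt {s : Set ℝ} {w : ℝ → ℝ}
    [IsFiniteMeasure (intervalWeightMeasure s w)] (h : HasPolynomialONB s w) {f : s → ℂ}
    (hf : MemLp f 2 (intervalWeightMeasure s w)) {ε : ℝ} (hε : 0 < ε) :
    ∃ q : Polynomial ℂ, MemLp (fun x : s => q.eval ((x : ℝ) : ℂ)) 2 (intervalWeightMeasure s w) ∧
      ∫ x, ‖f x - q.eval ((x : ℝ) : ℂ)‖ ∂(intervalWeightMeasure s w) < ε := by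
  unfold HasPolynomialONB at h
  set ν := intervalWeightMeasure s w
  obtain ⟨b, hb⟩ := h
  have hspan : ∀ g ∈ Submodule.span ℂ (Set.range b), ∃ q : Polynomial ℂ,
      (g : s → ℂ) =ᵐ[ν] fun x => q.eval ((x : ℝ) : ℂ) := by
    intro g hg
    induction hg using Submodule.span_induction with
    | mem g hg => obtain ⟨k, rfl⟩ := hg; exact hb k
    | zero => exact ⟨0, by simpa [Pi.zero_def] using Lp.coeFn_zero ℂ 2 ν⟩
    | add g₁ g₂ _ _ h₁ h₂ =>
      obtain ⟨q₁, h₁⟩ := h₁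
      obtain ⟨q₂, h₂⟩ := h₂
      refine ⟨q₁ + q₂, (Lp.coeFn_add g₁ g₂).trans ?_⟩
      filter_upwards [h₁, h₂] with x e₁ e₂
      simp [e₁, e₂]
    | smul a g _ h =>
      obtain ⟨q, h⟩ := h
      refine ⟨a • q, (Lp.coeFn_smul a g).trans ?_⟩
      filter_upwards [h] with x e
      simp [e]
  -- The Cauchy–Schwarz constant comparing `L¹` with `L²`; the `+ 1` keeps it positive when `ν = 0`.
  set K : ℝ := ν.real Set.univ ^ (1 / 2 : ℝ) + 1 with hK
  have hKpos : 0 < K := by positivity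
  have hmem : hf.toLp f ∈ closure (Submodule.span ℂ (Set.range b) : Set (Lp ℂ 2 ν)) := by
    rw [← Submodule.topologicalClosure_coe, b.dense_span]
    trivial
  obtain ⟨g, hg, hdist⟩ := Metric.mem_closure_iff.1 hmem (ε / K) (by positivity)
  obtain ⟨q, hq⟩ := hspan g hg
  have hqL : MemLp (fun x : s => q.eval ((x : ℝ) : ℂ)) 2 ν := (memLp_congr_ae hq).1 (Lp.memLp g)
  refine ⟨q, hqL, ?_⟩
  set d : s → ℂ := fun x => f x - q.eval ((x : ℝ) : ℂ) with hd
  have hdL : MemLp d 2 ν := hf.sub hqL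
  have hnorm : (eLpNorm d 2 ν).toReal < ε / K := by
    rw [dist_eq_norm, Lp.norm_def] at hdist
    refine lt_of_eq_of_lt (congrArg _ (eLpNorm_congr_ae ?_)) hdist
    filter_upwards [Lp.coeFn_sub (hf.toLp f) g, hf.coeFn_toLp, hq] with x e₁ e₂ e₃
    rw [e₁, Pi.sub_apply, e₂, e₃]
  have hle : eLpNorm d 1 ν ≤ eLpNorm d 2 ν * ν Set.univ ^ (1 / 2 : ℝ) := by
    refine (eLpNorm_le_eLpNorm_mul_rpow_measure_univ (p := 1) (q := 2) (by norm_num) hdL.1).trans_eq ?_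
    norm_num
  have hint : ∫ x, ‖d x‖ ∂ν = (eLpNorm d 1 ν).toReal := by
    rw [eLpNorm_one_eq_lintegral_enorm, integral_norm_eq_lintegral_enorm hdL.1]
  change ∫ x, ‖d x‖ ∂ν < ε
  rw [hint]
  have hfin : eLpNorm d 2 ν * ν Set.univ ^ (1 / 2 : ℝ) ≠ ⊤ :=
    ENNReal.mul_ne_top hdL.2.ne (ENNReal.rpow_ne_top_of_nonneg (by norm_num) (measure_ne_top _ _))
  calc (eLpNorm d 1 ν).toReal ≤ (eLpNorm d 2 ν * ν Set.univ ^ (1 / 2 : ℝ)).toReal :=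
        ENNReal.toReal_mono hfin hle
    _ = (eLpNorm d 2 ν).toReal * ν.real Set.univ ^ (1 / 2 : ℝ) := by
        rw [ENNReal.toReal_mul, ← ENNReal.toReal_rpow]; rfl
    _ ≤ (eLpNorm d 2 ν).toReal * K := by gcongr; simp [hK]
    _ < ε / K * K := by gcongr
    _ = ε := by field_simp

/-! ### Polynomials separate bounded functions -/

section PolynomialSeparation

variable {p : ℕ} {I : Fin p → Set ℝ} {w : Fin p → ℝ → ℝ}
  [∀ i, IsFiniteMeasure (intervalWeightMeasure (I i) (w i))]

theorem norm_integral_mul_prod_le {S : (∀ i, I i) → ℂ} {C : ℝ}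
    (hSC : ∀ᵐ x ∂(Measure.pi fun i => intervalWeightMeasure (I i) (w i)), ‖S x‖ ≤ C)
    {f : ∀ i, I i → ℂ} (hf : ∀ i, Integrable (f i) (intervalWeightMeasure (I i) (w i))) :
    ‖∫ x, S x * ∏ i, f i (x i) ∂(Measure.pi fun i => intervalWeightMeasure (I i) (w i))‖ ≤
      C * ∏ i, ∫ x, ‖f i x‖ ∂(intervalWeightMeasure (I i) (w i)) := by
  rw [← integral_fintype_prod_eq_prod (fun i x => ‖f i x‖), ← integral_const_mul]
  refine norm_integral_le_of_norm_le
    ((Integrable.fintype_prod_dep fun i => (hf i).norm).const_mul C) ?_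
  filter_upwards [hSC] with x hx
  rw [norm_mul, norm_prod]
  exact mul_le_mul_of_nonneg_right hx (Finset.prod_nonneg fun i _ => norm_nonneg _)

theorem integrable_mul_prod {S : (∀ i, I i) → ℂ} {C : ℝ}
    (hS : Integrable S (Measure.pi fun i => intervalWeightMeasure (I i) (w i)))
    (hSC : ∀ᵐ x ∂(Measure.pi fun i => intervalWeightMeasure (I i) (w i)), ‖S x‖ ≤ C)
    {f : ∀ i, I i → ℂ} (hf : ∀ i, Integrable (f i) (intervalWeightMeasure (I i) (w i))) :
    Integrable (fun x => S x * ∏ i, f i (x i))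
      (Measure.pi fun i => intervalWeightMeasure (I i) (w i)) :=
  (Integrable.fintype_prod_dep hf).bdd_mul hS.1 hSC

/-- Induction on the set `t` of coordinates whose factor may be non-polynomial. With none left the
product is a polynomial on the box; each further factor is approximated by a polynomial in `L¹`, the
boundedness of `S` controlling the error. -/
theorem integral_mul_prod_eq_zero (h_onb : ∀ i, HasPolynomialONB (I i) (w i))
    {S : (∀ i, I i) → ℂ} {C : ℝ}
    (hS : Integrable S (Measure.pi fun i => intervalWeightMeasure (I i) (w i)))
    (hSC : ∀ᵐ x ∂(Measure.pi fun i => intervalWeightMeasure (I i) (w i)), ‖S x‖ ≤ C)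
    (h0 : ∀ q : MvPolynomial (Fin p) ℂ, ∫ x, S x * boxPolynomial I q x
      ∂(Measure.pi fun i => intervalWeightMeasure (I i) (w i)) = 0)
    (t : Finset (Fin p)) : ∀ f : ∀ i, I i → ℂ,
      (∀ i, MemLp (f i) 2 (intervalWeightMeasure (I i) (w i))) →
      (∀ i ∉ t, ∃ q : Polynomial ℂ, f i = fun x : I i => q.eval ((x : ℝ) : ℂ)) →
      ∫ x, S x * ∏ i, f i (x i) ∂(Measure.pi fun i => intervalWeightMeasure (I i) (w i)) = 0 := by
  induction t using Finset.induction_on with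
  | empty =>
    intro f _ hf
    choose q hq using fun i => hf i (Finset.notMem_empty i)
    rw [← h0 (∏ i, Polynomial.aeval (MvPolynomial.X i) (q i))]
    refine integral_congr_ae (ae_of_all _ fun x => ?_)
    simp only [boxPolynomial, map_prod, hq]
    congr 1
    refine Finset.prod_congr rfl fun i _ => ?_
    have h := Polynomial.hom_eval₂ (q i) MvPolynomial.C
      (MvPolynomial.eval fun i => ((x i : ℝ) : ℂ)) (MvPolynomial.X i)
    have hC : (MvPolynomial.eval fun i => ((x i : ℝ) : ℂ)).comp MvPolynomial.C = RingHom.id ℂ := by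
      ext; simp
    rw [Polynomial.aeval_def, MvPolynomial.algebraMap_eq, h, hC, MvPolynomial.eval_X]
    rfl
  | insert j t hj ih =>
    intro f hf hpoly
    have hfi := fun i => (hf i).integrable (by norm_num)
    set R : ℝ := ∏ i ∈ Finset.univ.erase j, ∫ x, ‖f i x‖ ∂(intervalWeightMeasure (I i) (w i)) with hR
    have hR0 : 0 ≤ R := Finset.prod_nonneg fun i _ => integral_nonneg fun x => norm_nonneg _
    -- `|C|` is needed because `C` may be negative if the measure is zero.
    have hbound : ∀ ε > 0, ‖∫ x, S x * ∏ i, f i (x i)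
        ∂(Measure.pi fun i => intervalWeightMeasure (I i) (w i))‖ ≤ |C| * (ε * R) := by
      intro ε hε
      obtain ⟨q, hqL, hq⟩ := (h_onb j).exists_polynomial_integral_norm_sub_lt (hf j) hε
      set g : I j → ℂ := fun x => q.eval ((x : ℝ) : ℂ) with hg
      have hup : ∀ (h : I j → ℂ) (x : ∀ i, I i), ∏ i, Function.update f j h i (x i) =
          h (x j) * ∏ i ∈ Finset.univ.erase j, f i (x i) := by
        intro h x
        rw [← Finset.mul_prod_erase _ _ (Finset.mem_univ j), Function.update_self]
        congr 1
        refine Finset.prod_congr rfl fun i hi => ?_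
        rw [Function.update_of_ne (Finset.ne_of_mem_erase hi)]
      have hgL : ∀ i, MemLp (Function.update f j g i) 2 (intervalWeightMeasure (I i) (w i)) := by
        intro i
        rcases eq_or_ne i j with rfl | hij
        · rwa [Function.update_self]
        · rw [Function.update_of_ne hij]; exact hf i
      have hdL : ∀ i, Integrable (Function.update f j (fun x => f j x - g x) i)
          (intervalWeightMeasure (I i) (w i)) := by
        intro i
        rcases eq_or_ne i j with rfl | hij
        · rw [Function.update_self]
          exact (hfi i).sub (hqL.integrable (by norm_num))
        · rw [Function.update_of_ne hij]; exact hfi i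
      have hzero := ih (Function.update f j g) hgL fun i hi => by
        rcases eq_or_ne i j with rfl | hij
        · exact ⟨q, by rw [Function.update_self]⟩
        · rw [Function.update_of_ne hij]
          exact hpoly i (by simp [hij, hi])
      have hsub : ∫ x, S x * ∏ i, f i (x i)
          ∂(Measure.pi fun i => intervalWeightMeasure (I i) (w i)) =
          ∫ x, S x * ∏ i, Function.update f j (fun x => f j x - g x) i (x i)
            ∂(Measure.pi fun i => intervalWeightMeasure (I i) (w i)) := by
        rw [← sub_zero (∫ x, S x * ∏ i, f i (x i) ∂_), ← hzero, ← integral_sub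
          (integrable_mul_prod hS hSC hfi)
          (integrable_mul_prod hS hSC fun i => (hgL i).integrable (by norm_num))]
        refine integral_congr_ae (ae_of_all _ fun x => ?_)
        simp only [hup]
        rw [← Finset.mul_prod_erase _ _ (Finset.mem_univ j)]
        ring
      rw [hsub]
      refine (norm_integral_mul_prod_le (hSC.mono fun x hx => hx.trans (le_abs_self C)) hdL).trans ?_
      gcongr
      rw [← Finset.mul_prod_erase _ _ (Finset.mem_univ j), Function.update_self]
      have : ∏ i ∈ Finset.univ.erase j, ∫ x, ‖Function.update f j (fun x => f j x - g x) i x‖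
          ∂(intervalWeightMeasure (I i) (w i)) = R := by
        refine Finset.prod_congr rfl fun i hi => ?_
        rw [Function.update_of_ne (Finset.ne_of_mem_erase hi)]
      rw [this]
      gcongr
    have hlim : Filter.Tendsto (fun ε : ℝ => |C| * (ε * R)) (nhdsWithin 0 (Set.Ioi 0)) (nhds 0) := by
      have : Continuous fun ε : ℝ => |C| * (ε * R) := by fun_prop
      simpa using (this.tendsto 0).mono_left nhdsWithin_le_nhds
    exact norm_le_zero_iff.1 (ge_of_tendsto hlim (Filter.eventually_of_mem self_mem_nhdsWithin hbound))

/-- Polynomials separate bounded functions on the box. -/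
theorem ae_eq_zero_of_forall_integral_mul_boxPolynomial_eq_zero
    (h_onb : ∀ i, HasPolynomialONB (I i) (w i)) {S : (∀ i, I i) → ℂ} {C : ℝ}
    (hS : Integrable S (Measure.pi fun i => intervalWeightMeasure (I i) (w i)))
    (hSC : ∀ᵐ x ∂(Measure.pi fun i => intervalWeightMeasure (I i) (w i)), ‖S x‖ ≤ C)
    (h0 : ∀ q : MvPolynomial (Fin p) ℂ, ∫ x, S x * boxPolynomial I q x
      ∂(Measure.pi fun i => intervalWeightMeasure (I i) (w i)) = 0) :
    S =ᵐ[Measure.pi fun i => intervalWeightMeasure (I i) (w i)] 0 := by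
  have hrect : ∀ X : ∀ i, Set (I i), (∀ i, MeasurableSet (X i)) → ∫ x in Set.univ.pi X, S x
      ∂(Measure.pi fun i => intervalWeightMeasure (I i) (w i)) = 0 := by
    intro X hX
    rw [← integral_mul_prod_eq_zero h_onb hS hSC h0 Finset.univ
      (fun i => (X i).indicator fun _ => 1) (fun i => (memLp_const 1).indicator (hX i))
      (fun i hi => absurd (Finset.mem_univ i) hi), ← integral_indicator (.univ_pi hX)]
    refine integral_congr_ae (ae_of_all _ fun x => ?_)
    by_cases hx : x ∈ Set.univ.pi X
    · simp only [Set.indicator_of_mem hx]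
      rw [Finset.prod_eq_one fun i _ => Set.indicator_of_mem (hx i trivial) _, mul_one]
    · simp only [Set.indicator_of_notMem hx]
      simp only [Set.mem_pi, Set.mem_univ, true_imp_iff, not_forall] at hx
      obtain ⟨i, hi⟩ := hx
      rw [Finset.prod_eq_zero (Finset.mem_univ i) (Set.indicator_of_notMem hi _), mul_zero]
  refine hS.ae_eq_zero_of_forall_setIntegral_eq_zero fun X hX _ => ?_
  have huniv : ∫ x, S x ∂(Measure.pi fun i => intervalWeightMeasure (I i) (w i)) = 0 := by
    simpa using hrect (fun _ => Set.univ) fun _ => .univ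
  refine MeasurableSpace.induction_on_inter (C := fun X _ => ∫ x in X, S x
      ∂(Measure.pi fun i => intervalWeightMeasure (I i) (w i)) = 0)
    -- Rectangles form a generating π-system, so vanishing on them extends to all measurable sets.
    generateFrom_pi.symm isPiSystem_pi ?_ ?_ ?_ ?_ X hX
  · simp
  · rintro _ ⟨Y, hY, rfl⟩
    exact hrect Y fun i => hY i trivial
  · intro X hX ih
    have := integral_add_compl hX hS
    rwa [ih, huniv, zero_add] at this
  · intro X hd hX ih
    rw [integral_iUnion hX hd hS.integrableOn]
    simp [ih]

end PolynomialSeparation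

/-! ### The main theorem -/

theorem proposition1 {p : ℕ} (I : Fin p → Set ℝ) (hI : ∀ i, (I i).OrdConnected)
    (w : Fin p → ℝ → ℝ) (hw_pos : ∀ i, ∀ x ∈ I i, 0 < w i x)
    (hw_int : ∀ i, IntegrableOn (w i) (I i))
    (h_onb : ∀ i, HasPolynomialONB (I i) (w i))
    {H : Type*} [NormedAddCommGroup H] [InnerProductSpace ℂ H] [CompleteSpace H]
    {ι : Type*} (e : HilbertBasis ι ℂ H)
    (P : Set (∀ i, I i) → H →L[ℂ] H) (hP : IsPOVM P)
    (ψ : ι → (∀ i, I i) → ℂ)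
    (h_dil : IsMinimalScalarDilation P e (boxWeightMeasure I w) ψ)
    (h_poly : ∀ m, ∃ q : MvPolynomial (Fin p) ℂ, ψ m = boxPolynomial I q)
    (h_span : ∀ q : MvPolynomial (Fin p) ℂ, boxPolynomial I q ∈
      Submodule.span ℂ (Set.range fun nm : ι × ι =>
        fun x => starRingEnd ℂ (ψ nm.1 x) * ψ nm.2 x)) :
    IsPurePOVM P := by
  have hmeas : ∀ i, MeasurableSet (I i) := fun i => (hI i).measurableSet
  have := fun i => isFiniteMeasure_intervalWeightMeasure (hmeas i) (hw_int i)
  obtain ⟨hψ, hinner, -⟩ := h_dil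
  rw [boxWeightMeasure_eq_pi hmeas hw_pos hw_int] at hψ hinner
  have hψψ : ∀ n m, Integrable (fun x => starRingEnd ℂ (ψ n x) * ψ m x)
      (Measure.pi fun i => intervalWeightMeasure (I i) (w i)) := fun n m =>
    (hψ n).star.integrable_mul (hψ m)
  refine hP.isPurePOVM_of_separating e hψ hinner ?_ fun S C hS hSC h0 => ?_
  · convert h_span 1 using 1
    funext x
    simp [boxPolynomial]
  · refine ae_eq_zero_of_forall_integral_mul_boxPolynomial_eq_zero h_onb hS hSC fun q => ?_
    -- Integrability is carried through the span induction because additivity of the integral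
    -- requires it.
    suffices h : ∀ f ∈ Submodule.span ℂ (Set.range fun nm : ι × ι =>
        fun x => starRingEnd ℂ (ψ nm.1 x) * ψ nm.2 x),
        Integrable (fun x => S x * f x)
          (Measure.pi fun i => intervalWeightMeasure (I i) (w i)) ∧
        ∫ x, S x * f x ∂(Measure.pi fun i => intervalWeightMeasure (I i) (w i)) = 0 from
      (h _ (h_span q)).2
    intro f hf
    induction hf using Submodule.span_induction with
    | mem f hf =>
      obtain ⟨nm, rfl⟩ := hf
      exact ⟨(hψψ _ _).bdd_mul hS.1 hSC, h0 _ _⟩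
    | zero => simp
    | add f g _ _ hf hg =>
      simp only [Pi.add_apply, mul_add]
      exact ⟨hf.1.add hg.1, by rw [integral_add hf.1 hg.1, hf.2, hg.2, add_zero]⟩
    | smul a f _ hf =>
      simp only [Pi.smul_apply, smul_eq_mul, mul_left_comm]
      exact ⟨hf.1.const_mul a, by rw [integral_const_mul, hf.2, mul_zero]⟩
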